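/- Let $d\in\mathbb N$ and $\beta\in(0,d]$. For $E\subset\mathbb R^d$ let $$\mathcal H^\beta_\infty(E)=\inf\Big\{\sum_{i=1}^\infty\omega_\beta r_i^\beta : E\subset\bigcup_{i=1}^\infty B(x_i,r_i)\Big\},\qquad \omega_\beta=\frac{\pi^{\beta/2}}{\Gamma(\beta/2+1)},$$ be the spherical Hausdorff content, and for a set $Q\subset\mathbb R^d$ and a function $f\ge 0$ let $\int_Q f\,d\mathcal H^\beta_\infty=\int_0^\infty\mathcal H^\beta_\infty(\{x\in Q: f(x)>t\})\,dt\in[0,\infty]$ be the Choquet integral. Cubes are half-open, of arbitrary orientation, and $l(Q)\in(0,\infty)$ denotes the side length of a finite cube $Q$. Let $Q_0$ be a finite cube in $\mathbb R^d$ of some orientation, or $Q_0=\mathbb R^d$ with some fixed orientation. Let $L^1(Q_0;\mathcal H^\beta_\infty)$ be the set of functions $u:Q_0\to\mathbb R$ with $\int_{Q_0}|u|\,d\mathcal H^\beta_\infty<\infty$ that are $\mathcal H^\beta_\infty$-quasicontinuous, i.e. for every $\epsilon>0$ there is an open set $O$ with $\mathcal H^\beta_\infty(O)<\epsilon$ such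 that $u|_{Q_0\setminus O}$ is continuous. Put $$\|u\|_{BMO^\beta(Q_0)}=\sup_{Q\subset Q_0}\ \inf_{c\in\mathbb R}\ \frac1{l(Q)^\beta}\int_Q|u-c|\,d\mathcal H^\beta_\infty,$$ the supremum being over all finite subcubes $Q\subset Q_0$ parallel to $Q_0$, and $BMO^\beta(Q_0)=\{u\in L^1(Q_0;\mathcal H^\beta_\infty):\|u\|_{BMO^\beta(Q_0)}<\infty\}$. Then there exist constants $c',C'>0$, depending only on $d$ and $\beta$, such that for every such $Q_0$, every $u\in BMO^\beta(Q_0)$ with $\|u\|_{BMO^\beta(Q_0)}\le 1$ and every finite subcube $Q\subset Q_0$ parallel to $Q_0$, there is $c_Q\in\mathbb R$ with $$\int_Q\exp\big(c'|u-c_Q|\big)\,d\mathcal H^\beta_\infty\le C'\,l(Q)^\beta .$$ -/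

import Mathlib

open scoped ENNReal NNReal

noncomputable section

namespace HausdorffBMO

/-- The normalization constant `ω_β = π^(β/2) / Γ(β/2 + 1)`. -/
def ballConst (β : ℝ) : ℝ :=
  Real.pi ^ (β / 2) / Real.Gamma (β / 2 + 1)

/-- The (spherical) `β`-dimensional Hausdorff content of an arbitrary set `S ⊆ ℝ^d`: the infimum of
`∑ ω_β r_i^β` over all countable coverings of `S` by open balls `B(x_i, r_i)`
(a ball of radius `0` is empty and contributes `0`, so finite coverings are included). -/
def content {d : ℕ} (β : ℝ) (S : Set (EuclideanSpace ℝ (Fin d))) : ℝ≥0∞ :=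
  ⨅ (x : ℕ → EuclideanSpace ℝ (Fin d)) (r : ℕ → ℝ≥0) (_ : S ⊆ ⋃ i, Metric.ball (x i) (r i)),
    ∑' i, ENNReal.ofReal (ballConst β * (r i : ℝ) ^ β)

/-- The Choquet integral `∫_Q f dH = ∫_0^∞ H({x ∈ Q : f(x) > t}) dt` of a non-negative function `f`
over `Q` with respect to the `β`-dimensional Hausdorff content. The integrand on the right is
monotone in `t`, hence measurable; the value may be `∞`. -/
def choquet {d : ℕ} (β : ℝ) (Q : Set (EuclideanSpace ℝ (Fin d)))
    (f : EuclideanSpace ℝ (Fin d) → ℝ) : ℝ≥0∞ :=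
  ∫⁻ t in Set.Ioi (0 : ℝ), content β {x | x ∈ Q ∧ t < f x}

/-- `u`, regarded as a function on `Q₀`, is quasicontinuous with respect to the Hausdorff content:
for every `ε > 0` there is an open set `O` of content less than `ε` such that the restriction of
`u` to the complement `Q₀ \ O` is continuous. -/
def QuasicontinuousOn {d : ℕ} (β : ℝ) (Q₀ : Set (EuclideanSpace ℝ (Fin d)))
    (u : EuclideanSpace ℝ (Fin d) → ℝ) : Prop :=
  ∀ ε : ℝ≥0∞, 0 < ε → ∃ O : Set (EuclideanSpace ℝ (Fin d)),
    IsOpen O ∧ content β O < ε ∧ ContinuousOn u (Q₀ \ O)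

/-- `u ∈ L¹(Q₀; H^β_∞)`. -/
def MemL1 {d : ℕ} (β : ℝ) (Q₀ : Set (EuclideanSpace ℝ (Fin d)))
    (u : EuclideanSpace ℝ (Fin d) → ℝ) : Prop :=
  QuasicontinuousOn β Q₀ u ∧ choquet β Q₀ (fun x => |u x|) < ∞

/-- The half-open cube of side length `l` whose edges are parallel to the orthonormal frame `b` and
whose lower corner has coordinates `a` in that frame. -/
def cube {d : ℕ} (b : OrthonormalBasis (Fin d) ℝ (EuclideanSpace ℝ (Fin d)))
    (a : Fin d → ℝ) (l : ℝ) : Set (EuclideanSpace ℝ (Fin d)) :=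
  {x | ∀ i, b.repr x i ∈ Set.Ico (a i) (a i + l)}

/-- The seminorm `‖u‖_{BMO^β(Q₀)}`, with values in `[0, ∞]`: the supremum over all finite subcubes
`Q ⊆ Q₀` parallel to the frame `b` of `inf_c l(Q)^(-β) ∫_Q |u - c| dH^β_∞`. -/
def bmoNorm {d : ℕ} (β : ℝ) (b : OrthonormalBasis (Fin d) ℝ (EuclideanSpace ℝ (Fin d)))
    (Q₀ : Set (EuclideanSpace ℝ (Fin d))) (u : EuclideanSpace ℝ (Fin d) → ℝ) : ℝ≥0∞ :=
  ⨆ (a : Fin d → ℝ) (l : ℝ) (_ : 0 < l) (_ : cube b a l ⊆ Q₀),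
    ⨅ c : ℝ, choquet β (cube b a l) (fun x => |u x - c|) / ENNReal.ofReal (l ^ β)

/-- `u ∈ BMO^β(Q₀)`. -/
def MemBMO {d : ℕ} (β : ℝ) (b : OrthonormalBasis (Fin d) ℝ (EuclideanSpace ℝ (Fin d)))
    (Q₀ : Set (EuclideanSpace ℝ (Fin d))) (u : EuclideanSpace ℝ (Fin d) → ℝ) : Prop :=
  MemL1 β Q₀ u ∧ bmoNorm β b Q₀ u < ∞

end HausdorffBMO

end

open scoped ENNReal NNReal

noncomputable section

namespace HausdorffBMO

/-! This is a John–Nirenberg iteration. Chebyshev makes `E = {|u - c_Q| > K}` a subset of `Q` of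
content at most a small multiple of `l(Q)^β`. Suppose `E` is covered by subcubes `Q'` with `∑
l(Q')^β ≤ l(Q)^β / 2`, in each of which `E` still has small content. Then some point of `Q'` lies
outside both `E` and `{|u - c_{Q'}| > K}`, so `|c_{Q'} - c_Q| ≤ 2K`. Hence `{|u - c_Q| > (n+1)2K}`
is contained in the union of the sets `{|u - c_{Q'}| > n·2K}`, and each step halves the content
bound. Geometric decay gives exponential integrability.

Finding the `Q'` is the main point (`exists_stopping_nodes`, `exists_cover_by_subcubes`). Content is
not additive over disjoint cubes, so the stopping rule weighs a fixed dyadic cover of `E` instead: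
stop at the first cube whose cover cubes carry at least `θ` times its own weight. Distinct stopping
cubes own disjoint parts of the cover, so their weights sum to at most `1/θ` times that of the
cover. Their parents, which failed the test, are the `Q'`; passing to parents costs a factor `2^β`.
The iteration (`content_superlevel_le_pow`) then needs only monotonicity and subadditivity of
content and two-sided bounds for cubes. -/

/-- Stopping-time selection in a tree. The sets `{x | π n x = k}` are the nodes of level `n`; the
nodes `p i` cover `E` and have small total weight. The stopping nodes `j` absorb at least the
fraction `θ` of their weight, while their parents do not. -/
theorem exists_stopping_nodes {X κ ι : Type*} [Nonempty X] (π : ℕ → X → κ)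
    (hπ : ∀ {m n : ℕ}, m ≤ n → ∀ {x y : X}, π n x = π n y → π m x = π m y)
    (w : ℕ → ℝ≥0∞) {θ : ℝ≥0∞} (hθ1 : θ ≤ 1)
    {E : Set X} (p : ι → ℕ × κ)
    (hcov : ∀ x ∈ E, ∃ i, π (p i).1 x = (p i).2) (hsmall : ∑' i, w (p i).1 < θ * w 0) :
    ∃ (J : Set (ℕ × κ)) (y : ℕ × κ → X),
      (∀ j ∈ J, y j ∈ E ∧ j.1 ≠ 0) ∧
      (∀ x ∈ E, ∃ j ∈ J, π (j.1 - 1) x = π (j.1 - 1) (y j)) ∧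
      θ * ∑' j : J, w j.1.1 ≤ ∑' i, w (p i).1 ∧
      ∀ j ∈ J, ∃ I : Set ι,
        (∀ x ∈ E, π (j.1 - 1) x = π (j.1 - 1) (y j) → ∃ i ∈ I, π (p i).1 x = (p i).2) ∧
        ∑' i : I, w (p i).1 ≤ θ * w (j.1 - 1) := by
  classical
  let B : ℕ × κ → Set ι := fun q =>
    {i | q.1 ≤ (p i).1 ∧ ∃ z, π (p i).1 z = (p i).2 ∧ π q.1 z = q.2}
  let G : ℕ × κ → Prop := fun q => θ * w q.1 ≤ ∑' i : B q, w (p i).1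
  -- A cover node passes the test by itself because `θ ≤ 1`, so every branch through `E` stops no
  -- later than at its cover node.
  have hGp : ∀ i x, π (p i).1 x = (p i).2 → G ((p i).1, π (p i).1 x) := by
    intro i x hx
    have hi : i ∈ B ((p i).1, π (p i).1 x) := ⟨le_rfl, x, hx, rfl⟩
    calc θ * w (p i).1 ≤ 1 * w (p i).1 := by gcongr
      _ = w (p i).1 := one_mul _
      _ ≤ _ := ENNReal.le_tsum (f := fun i : B ((p i).1, π (p i).1 x) => w (p i).1) ⟨i, hi⟩
  have hG0 : ∀ k, ¬ G (0, k) := by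
    intro k hk
    exact absurd (hk.trans (ENNReal.tsum_comp_le_tsum_of_injective Subtype.val_injective _))
      hsmall.not_ge
  have hex : ∀ x ∈ E, ∃ n, G (n, π n x) := fun x hx => by
    obtain ⟨i, hi⟩ := hcov x hx
    exact ⟨_, hGp i x hi⟩
  let J : Set (ℕ × κ) :=
    {j | ∃ x ∈ E, π j.1 x = j.2 ∧ G j ∧ ∀ m < j.1, ¬ G (m, π m x)}
  have hJ : ∀ j ∈ J, ∃ x, x ∈ E ∧ π j.1 x = j.2 ∧ G j ∧ ∀ m < j.1, ¬ G (m, π m x) :=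
    fun j hj => hj
  choose! y hyE hy hyG hymin using hJ
  have hJ0 : ∀ j ∈ J, j.1 ≠ 0 := by
    intro j hj h0
    apply hG0 j.2
    rw [← h0]
    exact hyG j hj
  have hEJ : ∀ x ∈ E, ∃ j ∈ J, π j.1 x = j.2 := fun x hx =>
    ⟨(Nat.find (hex x hx), π (Nat.find (hex x hx)) x),
      ⟨x, hx, rfl, Nat.find_spec (hex x hx), fun m hm => Nat.find_min (hex x hx) hm⟩, rfl⟩
  -- Two nodes above a common cover node are comparable. The higher one would already have stopped
  -- the branch of the lower one.
  have hle : ∀ i, ∀ j ∈ J, ∀ j' ∈ J, i ∈ B j → i ∈ B j' → j'.1 ≤ j.1 := by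
    rintro i j hj j' hj' ⟨h1, z, hz, hzj⟩ ⟨h1', z', hz', hzj'⟩
    by_contra! hlt
    apply hymin j' hj' j.1 hlt
    have e1 : π j.1 (y j') = π j.1 z' := hπ hlt.le ((hy j' hj').trans hzj'.symm)
    have e2 : π j.1 z' = π j.1 z := hπ h1 (hz'.trans hz.symm)
    rw [e1, e2, hzj]
    exact hyG j hj
  have huniq : ∀ i, ∀ j ∈ J, ∀ j' ∈ J, i ∈ B j → i ∈ B j' → j = j' := by
    intro i j hj j' hj' hi hi'
    have hlev : j.1 = j'.1 := le_antisymm (hle i j' hj' j hj hi' hi) (hle i j hj j' hj' hi hi')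
    obtain ⟨h1, z, hz, hzj⟩ := hi
    obtain ⟨h1', z', hz', hzj'⟩ := hi'
    refine Prod.ext hlev ?_
    rw [← hzj, ← hzj', ← hlev]
    exact hπ h1 (hz.trans hz'.symm)
  refine ⟨J, y, fun j hj => ⟨hyE j hj, hJ0 j hj⟩, ?_, ?_, ?_⟩
  · intro x hx
    obtain ⟨j, hj, hxj⟩ := hEJ x hx
    exact ⟨j, hj, hπ (Nat.sub_le _ _) (hxj.trans (hy j hj).symm)⟩
  · calc θ * ∑' j : J, w j.1.1 = ∑' j : J, θ * w j.1.1 := ENNReal.tsum_mul_left.symm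
      _ ≤ ∑' j : J, ∑' i : B j.1, w (p i).1 :=
          ENNReal.tsum_le_tsum fun j => hyG j.1 j.2
      _ = ∑' j : J, ∑' i, (B j.1).indicator (fun i => w (p i).1) i := by
          simp_rw [tsum_subtype (B _) (fun i => w (p i).1)]
      _ = ∑' i, ∑' j : J, (B j.1).indicator (fun i => w (p i).1) i := ENNReal.tsum_comm
      _ ≤ ∑' i, w (p i).1 := ENNReal.tsum_le_tsum fun i => by
          by_cases h : ∃ j : J, i ∈ B j.1
          · obtain ⟨j, hj⟩ := h
            rw [tsum_eq_single j]
            · exact Set.indicator_le_self _ _ _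
            · intro j' hne
              refine Set.indicator_of_notMem (fun hj' => hne ?_) _
              exact Subtype.ext (huniq i _ j'.2 _ j.2 hj' hj)
          · push Not at h
            simp [Set.indicator_of_notMem (h _)]
  · intro j hj
    refine ⟨B (j.1 - 1, π (j.1 - 1) (y j)), ?_, ?_⟩
    · intro x hx hxy
      obtain ⟨i, hi⟩ := hcov x hx
      refine ⟨i, ⟨?_, x, hi, hxy⟩, hi⟩
      -- A cover node strictly above the parent would pass the test on the branch of `y j` too
      -- early.
      by_contra! hlt
      have hlt' : (p i).1 < j.1 - 1 := hlt
      have hxy' : π (p i).1 x = π (p i).1 (y j) := hπ hlt'.le hxy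
      refine hymin j hj (p i).1 (by omega) ?_
      exact hGp i _ (hxy'.symm.trans hi)
    · have := hymin j hj (j.1 - 1) (by have := hJ0 j hj; omega)
      exact (not_le.1 this).le

/-! ### Hausdorff content: coverings and countable subadditivity -/

variable {d : ℕ} {β : ℝ}

theorem ballConst_pos (hβ : 0 < β) : 0 < ballConst β :=
  div_pos (Real.rpow_pos_of_pos Real.pi_pos _) (Real.Gamma_pos_of_pos (by positivity))

theorem content_mono {S T : Set (EuclideanSpace ℝ (Fin d))} (h : S ⊆ T) :
    content β S ≤ content β T :=
  le_iInf₂ fun x r => le_iInf fun hT => iInf₂_le_of_le x r (iInf_le _ (h.trans hT))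

/-- A covering indexed by an arbitrary countable type bounds the content. -/
theorem content_le_tsum_of_countable (hβ : 0 < β) {ι : Type*} [Countable ι]
    {S : Set (EuclideanSpace ℝ (Fin d))} (x : ι → EuclideanSpace ℝ (Fin d)) (r : ι → ℝ≥0)
    (h : S ⊆ ⋃ i, Metric.ball (x i) (r i)) :
    content β S ≤ ∑' i, ENNReal.ofReal (ballConst β * (r i : ℝ) ^ β) := by
  obtain ⟨f, hf⟩ := exists_injective_nat ι
  -- Unused indices get radius `0`: the ball is empty and costs `0 ^ β = 0`, as `β ≠ 0`.
  refine (iInf₂_le_of_le (Function.extend f x 0) (Function.extend f r 0) (iInf_le _ ?_)).trans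
    (le_of_eq ?_)
  · intro z hz
    obtain ⟨i, hi⟩ := Set.mem_iUnion.1 (h hz)
    refine Set.mem_iUnion.2 ⟨f i, ?_⟩
    rwa [hf.extend_apply, hf.extend_apply]
  · rw [← hf.tsum_eq]
    · simp [hf.extend_apply]
    · intro n hn
      by_contra hc
      apply hn
      simp [Function.extend_apply' _ _ _ hc, hβ.ne']

theorem content_ball_le (hβ : 0 < β) (x : EuclideanSpace ℝ (Fin d)) (r : ℝ≥0) :
    content β (Metric.ball x r) ≤ ENNReal.ofReal (ballConst β * (r : ℝ) ^ β) := by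
  refine (content_le_tsum_of_countable (ι := Unit) hβ (fun _ => x) (fun _ => r) ?_).trans ?_
  · exact Set.subset_iUnion (fun _ : Unit => Metric.ball x (r : ℝ)) ()
  · simp

theorem exists_cover_of_content_lt {S : Set (EuclideanSpace ℝ (Fin d))} {ε : ℝ≥0∞}
    (h : content β S < ε) :
    ∃ (x : ℕ → EuclideanSpace ℝ (Fin d)) (r : ℕ → ℝ≥0), S ⊆ ⋃ i, Metric.ball (x i) (r i) ∧
      ∑' i, ENNReal.ofReal (ballConst β * (r i : ℝ) ^ β) < ε := by
  simp only [content, iInf_lt_iff] at h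
  obtain ⟨x, r, hS, hlt⟩ := h
  exact ⟨x, r, hS, hlt⟩

/-- The Hausdorff content is countably subadditive. -/
theorem content_iUnion_le (hβ : 0 < β) {ι : Type*} [Countable ι]
    (S : ι → Set (EuclideanSpace ℝ (Fin d))) :
    content β (⋃ i, S i) ≤ ∑' i, content β (S i) := by
  by_cases htop : ∑' i, content β (S i) = ∞
  · simp [htop]
  refine ENNReal.le_of_forall_pos_le_add fun ε hε _ => ?_
  obtain ⟨δ, hδ, hsum⟩ := ENNReal.exists_pos_sum_of_countable' (ENNReal.coe_pos.2 hε).ne' ι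
  have hfin : ∀ i, content β (S i) ≠ ∞ := fun i => ENNReal.ne_top_of_tsum_ne_top htop i
  have hlt : ∀ i, content β (S i) < content β (S i) + δ i := fun i =>
    ENNReal.lt_add_right (hfin i) (hδ i).ne'
  choose x r hS hr using fun i => exists_cover_of_content_lt (hlt i)
  calc content β (⋃ i, S i)
      ≤ ∑' p : ι × ℕ, ENNReal.ofReal (ballConst β * (r p.1 p.2 : ℝ) ^ β) := by
        refine content_le_tsum_of_countable hβ (fun p : ι × ℕ => x p.1 p.2)
          (fun p => r p.1 p.2) ?_
        refine Set.iUnion_subset fun i z hz => ?_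
        obtain ⟨n, hn⟩ := Set.mem_iUnion.1 (hS i hz)
        exact Set.mem_iUnion.2 ⟨(i, n), hn⟩
    _ = ∑' i, ∑' n, ENNReal.ofReal (ballConst β * (r i n : ℝ) ^ β) :=
        ENNReal.tsum_prod (f := fun i n => ENNReal.ofReal (ballConst β * (r i n : ℝ) ^ β))
    _ ≤ ∑' i, (content β (S i) + δ i) := ENNReal.tsum_le_tsum fun i => (hr i).le
    _ = ∑' i, content β (S i) + ∑' i, δ i := ENNReal.tsum_add
    _ ≤ _ := by gcongr

theorem content_union_le (hβ : 0 < β) (S T : Set (EuclideanSpace ℝ (Fin d))) :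
    content β (S ∪ T) ≤ content β S + content β T := by
  rw [Set.union_eq_iUnion]
  refine (content_iUnion_le hβ _).trans (le_of_eq ?_)
  rw [tsum_bool]
  simp [add_comm]

/-! ### Content of cubes, from above and below -/

variable (b : OrthonormalBasis (Fin d) ℝ (EuclideanSpace ℝ (Fin d)))

theorem abs_repr_sub_le (x y : EuclideanSpace ℝ (Fin d)) (i : Fin d) :
    |b.repr x i - b.repr y i| ≤ dist x y := by
  rw [← b.repr.dist_map, dist_eq_norm]
  exact PiLp.norm_apply_le (b.repr x - b.repr y) i

theorem content_cube_le (hβ : 0 < β) (a : Fin d → ℝ) {l : ℝ} (hl : 0 < l) :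
    content β (cube b a l) ≤ ENNReal.ofReal (ballConst β * (d + 1) ^ β * l ^ β) := by
  have hsub : cube b a l ⊆
      Metric.ball (b.repr.symm (WithLp.toLp 2 a)) (((d + 1) * l).toNNReal) := by
    intro x hx
    rw [Real.coe_toNNReal _ (by positivity), Metric.mem_ball, ← b.repr.dist_map, b.repr.apply_symm_apply, EuclideanSpace.dist_eq,
      Real.sqrt_lt' (by positivity)]
    calc ∑ i, dist (b.repr x i) (a i) ^ 2 ≤ ∑ _i : Fin d, l ^ 2 := by
          refine Finset.sum_le_sum fun i _ => ?_
          have := hx i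
          rw [Real.dist_eq, sq_abs]
          exact pow_le_pow_left₀ (by linarith [this.1]) (by linarith [this.2]) 2
      _ = d * l ^ 2 := by simp
      _ < ((d + 1) * l) ^ 2 := by
          have : 0 < l ^ 2 := by positivity
          have hd : (0 : ℝ) ≤ d := by positivity
          nlinarith [mul_nonneg hd this.le, mul_nonneg (mul_nonneg hd hd) this.le]
  refine (content_mono hsub).trans ((content_ball_le hβ _ _).trans (le_of_eq ?_))
  rw [Real.coe_toNNReal _ (by positivity), Real.mul_rpow (by positivity) hl.le, mul_assoc]

open MeasureTheory in
theorem volume_cube (a : Fin d → ℝ) (l : ℝ) :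
    volume (cube b a l) = ENNReal.ofReal l ^ d := by
  have hpre : cube b a l = b.measurableEquiv ⁻¹'
      ((MeasurableEquiv.toLp 2 (Fin d → ℝ)).symm ⁻¹'
        Set.pi Set.univ fun i => Set.Ico (a i) (a i + l)) := by
    ext x
    simp only [cube, Set.mem_ofPred_eq, Set.mem_preimage, Set.mem_pi, Set.mem_univ, true_implies]
    rfl
  rw [hpre, b.measurePreserving_measurableEquiv.measure_preimage_equiv,
    (EuclideanSpace.volume_preserving_symm_measurableEquiv_toLp (Fin d)).measure_preimage_equiv,
    Real.volume_pi_Ico]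
  simp

open MeasureTheory in
theorem volume_ball_le (b : OrthonormalBasis (Fin d) ℝ (EuclideanSpace ℝ (Fin d)))
    (x : EuclideanSpace ℝ (Fin d)) (r : ℝ) :
    volume (Metric.ball x r) ≤ ENNReal.ofReal (2 * r) ^ d := by
  rw [← volume_cube b (fun i => b.repr x i - r)]
  refine measure_mono fun z hz i => ?_
  have h := (abs_repr_sub_le b z x i).trans_lt hz
  rw [abs_lt] at h
  constructor <;> linarith [h.1, h.2]

open MeasureTheory in
-- A ball of radius at least `l` already costs enough. If all radii are below `l`, then `β ≤ d`
-- gives `r^d ≤ l^(d-β) r^β`, and comparing Lebesgue measures bounds the sum from below.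
theorem le_content_cube (hβ : 0 < β) (hβd : β ≤ d) (a : Fin d → ℝ) {l : ℝ} (hl : 0 < l) :
    ENNReal.ofReal (ballConst β / 2 ^ d * l ^ β) ≤ content β (cube b a l) := by
  have hω := ballConst_pos hβ
  refine le_iInf₂ fun x r => le_iInf fun hcov => ?_
  by_cases hbig : ∃ i, l ≤ r i
  · obtain ⟨i, hi⟩ := hbig
    refine le_trans (ENNReal.ofReal_le_ofReal ?_) (ENNReal.le_tsum i)
    have h1 : l ^ β ≤ (r i : ℝ) ^ β := Real.rpow_le_rpow hl.le hi hβ.le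
    have h2 : ballConst β / 2 ^ d ≤ ballConst β :=
      div_le_self hω.le (one_le_pow₀ (by norm_num))
    have : 0 ≤ l ^ β := by positivity
    gcongr
  · push Not at hbig
    have hterm : ∀ i, ENNReal.ofReal (2 * (r i : ℝ)) ^ d ≤
        ENNReal.ofReal (2 ^ d * l ^ (d - β) / ballConst β) *
          ENNReal.ofReal (ballConst β * (r i : ℝ) ^ β) := by
      intro i
      rw [← ENNReal.ofReal_pow (by positivity), ← ENNReal.ofReal_mul (by positivity)]
      refine ENNReal.ofReal_le_ofReal ?_
      have hr : (r i : ℝ) ^ d ≤ l ^ (d - β) * (r i : ℝ) ^ β := by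
        rcases eq_or_lt_of_le (r i).coe_nonneg with h0 | h0
        · have hd : d ≠ 0 := by
            rintro rfl
            norm_num at hβd
            linarith
          rw [← h0, zero_pow hd]
          positivity
        · have : (r i : ℝ) ^ d = (r i : ℝ) ^ (d - β) * (r i : ℝ) ^ β := by
            rw [← Real.rpow_add h0, sub_add_cancel, Real.rpow_natCast]
          rw [this]
          have hexp : 0 ≤ d - β := sub_nonneg.2 hβd
          gcongr
          exact (hbig i).le
      calc (2 * (r i : ℝ)) ^ d = 2 ^ d * (r i : ℝ) ^ d := mul_pow _ _ _
        _ ≤ 2 ^ d * (l ^ (d - β) * (r i : ℝ) ^ β) := by gcongr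
        _ = _ := by field_simp
    have hvol : ENNReal.ofReal l ^ d ≤ ENNReal.ofReal (2 ^ d * l ^ (d - β) / ballConst β) *
        ∑' i, ENNReal.ofReal (ballConst β * (r i : ℝ) ^ β) := by
      rw [← volume_cube b a l, ← ENNReal.tsum_mul_left]
      exact ((measure_mono hcov).trans (measure_iUnion_le _)).trans
        (ENNReal.tsum_le_tsum fun i => (volume_ball_le b _ _).trans (hterm i))
    have hK : 0 < 2 ^ d * l ^ (d - β) / ballConst β := by positivity
    rw [← ENNReal.mul_le_mul_iff_right (a := ENNReal.ofReal (2 ^ d * l ^ (d - β) / ballConst β))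
      (by simpa using hK) ENNReal.ofReal_ne_top]
    refine le_trans (le_of_eq ?_) hvol
    rw [← ENNReal.ofReal_mul hK.le, ← ENNReal.ofReal_pow hl.le]
    congr 1
    have : l ^ d = l ^ (d - β) * l ^ β := by
      rw [← Real.rpow_add hl, sub_add_cancel, Real.rpow_natCast]
    rw [this]
    field_simp

/-! ### Dyadic cubes and coverings by them -/

/-- The index of the dyadic cube of generation `n` (relative to the cube with corner `a` and side
length `l`) that contains `x`. -/
def dyadicIndex (a : Fin d → ℝ) (l : ℝ) (n : ℕ) (x : EuclideanSpace ℝ (Fin d)) : Fin d → ℤ :=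
  fun i => ⌊(b.repr x i - a i) / l * 2 ^ n⌋

theorem dyadicIndex_eq_of_le {a : Fin d → ℝ} {l : ℝ} {m n : ℕ} (hmn : m ≤ n)
    {x y : EuclideanSpace ℝ (Fin d)} (h : dyadicIndex b a l n x = dyadicIndex b a l n y) :
    dyadicIndex b a l m x = dyadicIndex b a l m y := by
  -- The coarser index is the integer quotient of the finer one, so cubes are nested.
  have key : ∀ t : ℝ, ⌊t * 2 ^ m⌋ = ⌊t * 2 ^ n⌋ / ((2 ^ (n - m) : ℕ) : ℤ) := by
    intro t
    rw [← Int.floor_div_natCast]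
    congr 1
    obtain ⟨k, rfl⟩ := Nat.exists_eq_add_of_le hmn
    rw [Nat.add_sub_cancel_left]
    push_cast
    rw [pow_add]
    field_simp
  funext i
  have hi := congrFun h i
  simp only [dyadicIndex] at hi ⊢
  rw [key, key, hi]

theorem dyadicIndex_eq_iff {a : Fin d → ℝ} {l : ℝ} (hl : 0 < l) {n : ℕ} {k : Fin d → ℤ}
    {x : EuclideanSpace ℝ (Fin d)} :
    dyadicIndex b a l n x = k ↔ x ∈ cube b (fun i => a i + k i * (l / 2 ^ n)) (l / 2 ^ n) := by
  rw [funext_iff]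
  refine forall_congr' fun i => ?_
  simp only [dyadicIndex]
  have hs : (b.repr x i - a i) / l * 2 ^ n = (b.repr x i - a i) / (l / 2 ^ n) := by field_simp
  have hpos : 0 < l / 2 ^ n := by positivity
  rw [Int.floor_eq_iff, hs, le_div_iff₀ hpos, div_lt_iff₀ hpos, Set.mem_Ico, add_mul, one_mul]
  constructor <;> rintro ⟨h1, h2⟩ <;> constructor <;> linarith

theorem dyadicIndex_zero_eq_zero_iff {a : Fin d → ℝ} {l : ℝ} (hl : 0 < l)
    {x : EuclideanSpace ℝ (Fin d)} : dyadicIndex b a l 0 x = 0 ↔ x ∈ cube b a l := by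
  rw [dyadicIndex_eq_iff b hl]
  simp

/-- A set of small content has a covering by small dyadic cubes. -/
theorem exists_dyadic_cover (hβ : 0 < β) (a : Fin d → ℝ) {l : ℝ} (hl : 0 < l) {δ : ℝ}
    (hδ : 0 < δ) (hδ1 : δ ≤ 1) {E : Set (EuclideanSpace ℝ (Fin d))}
    (hE : content β E < ENNReal.ofReal (ballConst β * δ * l ^ β)) :
    ∃ (ι : Type) (p : ι → ℕ × (Fin d → ℤ)),
      (∀ x ∈ E, ∃ i, dyadicIndex b a l (p i).1 x = (p i).2) ∧
      ∑' i, ENNReal.ofReal ((l / 2 ^ (p i).1) ^ β) ≤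
        ENNReal.ofReal (3 ^ d * 2 ^ β * δ * l ^ β) := by
  have hω := ballConst_pos hβ
  obtain ⟨x, r, hcov, hsum⟩ := exists_cover_of_content_lt hE
  -- Since `δ ≤ 1`, no ball is as large as the cube, so its scale is a generation `n ≥ 0`.
  have hrl : ∀ i, (r i : ℝ) < l := by
    intro i
    have h1 := (ENNReal.le_tsum i).trans_lt hsum
    rw [ENNReal.ofReal_lt_ofReal_iff (by positivity)] at h1
    by_contra! hcon
    have h2 : l ^ β ≤ (r i : ℝ) ^ β := Real.rpow_le_rpow hl.le hcon hβ.le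
    have h3 : 0 < l ^ β := by positivity
    have : ballConst β * δ * l ^ β ≤ ballConst β * 1 * (r i : ℝ) ^ β := by gcongr
    linarith
  have hlev : ∀ i : {i // 0 < r i}, ∃ n : ℕ, (r i : ℝ) ≤ l / 2 ^ n ∧ l / 2 ^ n ≤ 2 * r i := by
    rintro ⟨i, hi⟩
    have hi' : (0 : ℝ) < r i := hi
    obtain ⟨n, h1, h2⟩ := exists_nat_pow_near_of_lt_one (div_pos hi' hl)
      ((div_le_one hl).2 (hrl i).le) (by norm_num : (0 : ℝ) < 1 / 2) (by norm_num)
    refine ⟨n, ?_, ?_⟩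
    · rw [div_le_iff₀ hl] at h2
      calc (r i : ℝ) ≤ (1 / 2) ^ n * l := h2
        _ = l / 2 ^ n := by rw [one_div_pow]; ring
    · rw [lt_div_iff₀ hl] at h1
      calc l / 2 ^ n = 2 * ((1 / 2) ^ (n + 1) * l) := by rw [one_div_pow]; field_simp; ring
        _ ≤ 2 * r i := by linarith
  choose n hn1 hn2 using hlev
  -- A ball of radius at most the mesh size meets only the cube of its centre and its neighbours.
  -- `Fin 3` shifted by `-1` encodes the offsets `-1, 0, 1` in each coordinate.
  refine ⟨{i // 0 < r i} × (Fin d → Fin 3),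
    fun q => (n q.1, fun i => dyadicIndex b a l (n q.1) (x q.1) i + ((q.2 i : ℕ) : ℤ) - 1), ?_, ?_⟩
  · intro z hz
    obtain ⟨i, hi⟩ := Set.mem_iUnion.1 (hcov hz)
    have hri : 0 < r i := by
      have : (0 : ℝ) < r i := dist_nonneg.trans_lt hi
      exact_mod_cast this
    set N := n ⟨i, hri⟩ with hN
    have hk : ∀ k, ∃ e : Fin 3, dyadicIndex b a l N z k =
        dyadicIndex b a l N (x i) k + ((e : ℕ) : ℤ) - 1 := by
      intro k
      have hclose : |(b.repr z k - a k) / l * 2 ^ N - (b.repr (x i) k - a k) / l * 2 ^ N| < 1 := by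
        have h1 : |b.repr z k - b.repr (x i) k| < l / 2 ^ N :=
          (abs_repr_sub_le b z (x i) k).trans_lt (lt_of_lt_of_le hi (hn1 ⟨i, hri⟩))
        have h2 : (b.repr z k - a k) / l * 2 ^ N - (b.repr (x i) k - a k) / l * 2 ^ N =
            (b.repr z k - b.repr (x i) k) / (l / 2 ^ N) := by
          field_simp
          ring
        have hpos : 0 < l / 2 ^ N := by positivity
        rwa [h2, abs_div, abs_of_pos hpos, div_lt_one hpos]
      simp only [dyadicIndex]
      generalize (b.repr z k - a k) / l * 2 ^ N = s at hclose
      generalize (b.repr (x i) k - a k) / l * 2 ^ N = t at hclose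
      rw [abs_lt] at hclose
      have h1 : ⌊s⌋ < ⌊t⌋ + 2 := by
        have : (⌊s⌋ : ℝ) < ⌊t⌋ + 2 := by
          linarith [Int.floor_le s, Int.lt_floor_add_one t, hclose.2]
        exact_mod_cast this
      have h2 : ⌊t⌋ < ⌊s⌋ + 2 := by
        have : (⌊t⌋ : ℝ) < ⌊s⌋ + 2 := by
          linarith [Int.floor_le t, Int.lt_floor_add_one s, hclose.1]
        exact_mod_cast this
      refine ⟨⟨(⌊s⌋ - ⌊t⌋ + 1).toNat, by omega⟩, ?_⟩
      simp only
      omega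
    choose e he using hk
    exact ⟨(⟨i, hri⟩, e), funext he⟩
  · have hterm : ∀ i : {i // 0 < r i}, ENNReal.ofReal ((l / 2 ^ n i) ^ β) ≤
        ENNReal.ofReal (2 ^ β / ballConst β) *
          ENNReal.ofReal (ballConst β * (r i : ℝ) ^ β) := by
      intro i
      rw [← ENNReal.ofReal_mul (by positivity)]
      refine ENNReal.ofReal_le_ofReal ?_
      calc (l / 2 ^ n i) ^ β ≤ (2 * (r i : ℝ)) ^ β :=
            Real.rpow_le_rpow (by positivity) (hn2 i) hβ.le
        _ = 2 ^ β * (r i : ℝ) ^ β := Real.mul_rpow (by norm_num) (r i).coe_nonneg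
        _ = _ := by field_simp
    calc ∑' q : {i // 0 < r i} × (Fin d → Fin 3), ENNReal.ofReal ((l / 2 ^ n q.1) ^ β)
        = ∑' i : {i // 0 < r i}, ∑' _ : Fin d → Fin 3, ENNReal.ofReal ((l / 2 ^ n i) ^ β) :=
          ENNReal.tsum_prod (f := fun i _ => ENNReal.ofReal ((l / 2 ^ n i) ^ β))
      _ = ∑' i : {i // 0 < r i}, 3 ^ d * ENNReal.ofReal ((l / 2 ^ n i) ^ β) := by
          simp [tsum_fintype]
      _ ≤ ∑' i : {i // 0 < r i}, 3 ^ d * (ENNReal.ofReal (2 ^ β / ballConst β) *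
            ENNReal.ofReal (ballConst β * (r i : ℝ) ^ β)) :=
          ENNReal.tsum_le_tsum fun i => by gcongr; exact hterm i
      _ = 3 ^ d * (ENNReal.ofReal (2 ^ β / ballConst β) *
            ∑' i : {i // 0 < r i}, ENNReal.ofReal (ballConst β * (r i : ℝ) ^ β)) := by
          rw [ENNReal.tsum_mul_left, ENNReal.tsum_mul_left]
      _ ≤ 3 ^ d * (ENNReal.ofReal (2 ^ β / ballConst β) *
            ENNReal.ofReal (ballConst β * δ * l ^ β)) := by
          gcongr
          exact (ENNReal.tsum_comp_le_tsum_of_injective Subtype.val_injective _).trans hsum.le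
      _ = ENNReal.ofReal (3 ^ d * 2 ^ β * δ * l ^ β) := by
          rw [← ENNReal.ofReal_mul (by positivity),
            show (3 : ℝ≥0∞) ^ d = ENNReal.ofReal (3 ^ d) by
              rw [ENNReal.ofReal_pow (by norm_num)]; norm_num,
            ← ENNReal.ofReal_mul (by positivity)]
          congr 1
          field_simp

/-- A subset of a cube with small content is covered by subcubes of small total size, in each of
which it still has small content. -/
theorem exists_cover_by_subcubes (hβ : 0 < β) (a : Fin d → ℝ) {l : ℝ} (hl : 0 < l) {δ θ : ℝ}
    (hδ : 0 < δ) (hδ1 : δ ≤ 1) (hθ1 : θ ≤ 1) (hδθ : 3 ^ d * 2 ^ β * δ < θ)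
    {E : Set (EuclideanSpace ℝ (Fin d))} (hEQ : E ⊆ cube b a l)
    (hE : content β E < ENNReal.ofReal (ballConst β * δ * l ^ β)) :
    ∃ (J : Type) (_ : Countable J) (a' : J → Fin d → ℝ) (l' : J → ℝ),
      (∀ j, 0 < l' j ∧ cube b (a' j) (l' j) ⊆ cube b a l) ∧
      E ⊆ ⋃ j, cube b (a' j) (l' j) ∧
      ∑' j, ENNReal.ofReal (l' j ^ β) ≤
        ENNReal.ofReal (2 ^ β * (3 ^ d * 2 ^ β * δ / θ) * l ^ β) ∧
      ∀ j, content β (E ∩ cube b (a' j) (l' j)) ≤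
        ENNReal.ofReal (ballConst β * (d + 1) ^ β * θ * l' j ^ β) := by
  have hω := ballConst_pos hβ
  have hθ : 0 < θ := lt_trans (by positivity) hδθ
  obtain ⟨ι, p, hcov, hsum⟩ := exists_dyadic_cover b hβ a hl hδ hδ1 hE
  set w : ℕ → ℝ≥0∞ := fun n => ENNReal.ofReal ((l / 2 ^ n) ^ β) with hw
  obtain ⟨J, y, hJ, hEJ, hJsum, hpar⟩ := exists_stopping_nodes (dyadicIndex b a l)
    (fun hmn _ _ h => dyadicIndex_eq_of_le b hmn h) w (θ := ENNReal.ofReal θ)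
    (by simpa using hθ1) (E := E) p hcov (by
      refine hsum.trans_lt ?_
      rw [hw, ← ENNReal.ofReal_mul hθ.le, ENNReal.ofReal_lt_ofReal_iff (by positivity)]
      simp only [pow_zero, div_one]
      gcongr)
  set L : ℕ → ℝ := fun n => l / 2 ^ n with hL
  have hLpos : ∀ n, 0 < L n := fun n => by positivity
  have hmem : ∀ n x z, x ∈ cube b (fun i => a i + dyadicIndex b a l n z i * L n) (L n) ↔
      dyadicIndex b a l n x = dyadicIndex b a l n z :=
    fun n x z => (dyadicIndex_eq_iff b hl).symm
  refine ⟨J, inferInstance, fun j i => a i + dyadicIndex b a l (j.1.1 - 1) (y j) i * L (j.1.1 - 1),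
    fun j => L (j.1.1 - 1), ?_, ?_, ?_, ?_⟩
  · refine fun j => ⟨hLpos _, fun x hx => ?_⟩
    rw [hmem] at hx
    -- The parent shares its generation-`0` ancestor with `y j ∈ E ⊆ Q`, and that ancestor is `Q`.
    rw [← dyadicIndex_zero_eq_zero_iff b hl, dyadicIndex_eq_of_le b (Nat.zero_le _) hx,
      dyadicIndex_zero_eq_zero_iff b hl]
    exact hEQ (hJ j.1 j.2).1
  · intro x hx
    obtain ⟨j, hj, hxj⟩ := hEJ x hx
    exact Set.mem_iUnion.2 ⟨⟨j, hj⟩, (hmem _ _ _).2 hxj⟩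
  · have hparent : ∀ j : J, ENNReal.ofReal (L (j.1.1 - 1) ^ β) =
        ENNReal.ofReal (2 ^ β) * w j.1.1 := by
      intro j
      rw [hw, ← ENNReal.ofReal_mul (by positivity), ← Real.mul_rpow (by norm_num) (by positivity)]
      obtain ⟨m, hm⟩ := Nat.exists_eq_succ_of_ne_zero (hJ j.1 j.2).2
      rw [hm, hL]
      congr 2
      simp only [Nat.succ_eq_add_one, Nat.add_sub_cancel, pow_succ]
      field_simp
    simp_rw [hparent]
    rw [ENNReal.tsum_mul_left]
    have h1 : ∑' j : J, w j.1.1 ≤ ENNReal.ofReal (3 ^ d * 2 ^ β * δ / θ * l ^ β) := by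
      rw [← ENNReal.mul_le_mul_iff_right (a := ENNReal.ofReal θ) (by simpa using hθ)
        ENNReal.ofReal_ne_top]
      refine (hJsum.trans hsum).trans (le_of_eq ?_)
      rw [← ENNReal.ofReal_mul hθ.le]
      congr 1
      field_simp
    refine (mul_le_mul_right h1 _).trans (le_of_eq ?_)
    rw [← ENNReal.ofReal_mul (by positivity), mul_assoc (2 ^ β)]
  · intro j
    obtain ⟨I, hI, hIsum⟩ := hpar j.1 j.2
    -- Positive weights with finite sum force countability, as subadditivity requires.
    have hIc : I.Countable := by
      refine (Set.countable_coe_iff.1 ?_)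
      have hne : ∑' i : I, w (p i).1 ≠ ∞ :=
        ne_top_of_le_ne_top (ENNReal.mul_ne_top ENNReal.ofReal_ne_top ENNReal.ofReal_ne_top) hIsum
      have := Summable.countable_support_ennreal hne
      have hsupp : (Function.support fun i : I => w (p i).1) = Set.univ := by
        refine Set.eq_univ_of_forall fun i => ?_
        have : 0 < (l / 2 ^ (p i).1) ^ β := by positivity
        simpa [hw] using this
      rw [hsupp] at this
      exact Set.countable_univ_iff.1 this
    have : Countable I := hIc.to_subtype
    calc content β (E ∩ cube b _ (L (j.1.1 - 1)))
        ≤ content β (⋃ i : I, cube b (fun k => a k + (p i).2 k * L (p i).1) (L (p i).1)) := by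
          refine content_mono ?_
          rintro x ⟨hx, hxj⟩
          obtain ⟨i, hi, hxi⟩ := hI x hx ((hmem _ _ _).1 hxj)
          exact Set.mem_iUnion.2 ⟨⟨i, hi⟩, (dyadicIndex_eq_iff b hl).1 hxi⟩
      _ ≤ ∑' i : I, content β (cube b (fun k => a k + (p i).2 k * L (p i).1) (L (p i).1)) :=
          content_iUnion_le hβ _
      _ ≤ ∑' i : I, ENNReal.ofReal (ballConst β * (d + 1) ^ β) * w (p i).1 := by
          refine ENNReal.tsum_le_tsum fun i => (content_cube_le b hβ _ (hLpos _)).trans ?_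
          rw [hw, ← ENNReal.ofReal_mul (by positivity)]
      _ ≤ ENNReal.ofReal (ballConst β * (d + 1) ^ β) *
            (ENNReal.ofReal θ * w (j.1.1 - 1)) := by
          rw [ENNReal.tsum_mul_left]
          gcongr
      _ = _ := by
          rw [hw, ← ENNReal.ofReal_mul hθ.le, ← ENNReal.ofReal_mul (by positivity), ← mul_assoc]

/-! ### Chebyshev's inequality and iteration over level sets -/

/-- Chebyshev's inequality for the Choquet integral. -/
theorem mul_content_lt_le_choquet (Q : Set (EuclideanSpace ℝ (Fin d)))
    (f : EuclideanSpace ℝ (Fin d) → ℝ) (K : ℝ) :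
    ENNReal.ofReal K * content β {x | x ∈ Q ∧ K < f x} ≤ choquet β Q f := by
  calc ENNReal.ofReal K * content β {x | x ∈ Q ∧ K < f x}
      = ∫⁻ _ in Set.Ioc (0 : ℝ) K, content β {x | x ∈ Q ∧ K < f x} := by
        rw [MeasureTheory.setLIntegral_const, Real.volume_Ioc, sub_zero, mul_comm]
    _ ≤ ∫⁻ t in Set.Ioc (0 : ℝ) K, content β {x | x ∈ Q ∧ t < f x} := by
        refine MeasureTheory.setLIntegral_mono' measurableSet_Ioc fun t ht => ?_
        exact content_mono fun x hx => ⟨hx.1, ht.2.trans_lt hx.2⟩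
    _ ≤ choquet β Q f := MeasureTheory.lintegral_mono_set Set.Ioc_subset_Ioi_self

theorem exists_choquet_le_of_bmoNorm_le_one {Q₀ : Set (EuclideanSpace ℝ (Fin d))}
    {u : EuclideanSpace ℝ (Fin d) → ℝ} (hu : bmoNorm β b Q₀ u ≤ 1) {a : Fin d → ℝ} {l : ℝ}
    (hl : 0 < l) (hQ : cube b a l ⊆ Q₀) :
    ∃ c : ℝ, choquet β (cube b a l) (fun x => |u x - c|) ≤ ENNReal.ofReal (2 * l ^ β) := by
  have h : ⨅ c : ℝ, choquet β (cube b a l) (fun x => |u x - c|) / ENNReal.ofReal (l ^ β) ≤ 1 := by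
    simp only [bmoNorm, iSup_le_iff] at hu
    exact hu a l hl hQ
  -- The infimum need not be attained; relaxing `1` to `2` yields an actual `c`.
  obtain ⟨c, hc⟩ := iInf_lt_iff.1 (h.trans_lt ENNReal.one_lt_two)
  have hpos : 0 < l ^ β := by positivity
  refine ⟨c, ?_⟩
  rw [ENNReal.ofReal_mul (by norm_num), ENNReal.ofReal_ofNat]
  exact (ENNReal.div_le_iff (by simpa using hpos) ENNReal.ofReal_ne_top).1 hc.le

/-- If on every cube `u` deviates by more than `K` from `c` only on a set of small content, then
the superlevel sets of the deviation decay geometrically. -/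
theorem content_superlevel_le_pow (hβ : 0 < β) (hβd : β ≤ d) {θ δ K : ℝ}
    (hδ : 0 < δ) (hδ1 : δ ≤ 1 / (4 * 2 ^ d)) (hθ1 : (d + 1) ^ β * θ ≤ 1 / (4 * 2 ^ d))
    (hθ : θ ≤ 1) (hδθ : 3 ^ d * 2 ^ β * δ < θ) (hhalf : 2 ^ β * (3 ^ d * 2 ^ β * δ / θ) ≤ 1 / 2)
    (hK : 0 ≤ K)
    {Q₀ : Set (EuclideanSpace ℝ (Fin d))} {u : EuclideanSpace ℝ (Fin d) → ℝ}
    {c : (Fin d → ℝ) → ℝ → ℝ}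
    (hc : ∀ a l, 0 < l → cube b a l ⊆ Q₀ → content β {x | x ∈ cube b a l ∧ K < |u x - c a l|} <
      ENNReal.ofReal (ballConst β * δ * l ^ β)) (n : ℕ) :
    ∀ a l, 0 < l → cube b a l ⊆ Q₀ →
      content β {x | x ∈ cube b a l ∧ n * (2 * K) < |u x - c a l|} ≤
        ENNReal.ofReal (ballConst β * (d + 1) ^ β * (1 / 2) ^ n * l ^ β) := by
  have hω := ballConst_pos hβ
  induction n with
  | zero =>
    intro a l hl _
    rw [pow_zero, mul_one]
    exact (content_mono fun x hx => hx.1).trans (content_cube_le b hβ a hl)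
  | succ n ih =>
    intro a l hl hQ
    set E := {x | x ∈ cube b a l ∧ K < |u x - c a l|} with hE
    have hδ1' : δ ≤ 1 := hδ1.trans <| (div_le_one (by positivity)).2 <| by
      have : (1 : ℝ) ≤ 2 ^ d := one_le_pow₀ (by norm_num)
      linarith
    obtain ⟨J, _, a', l', hsub, hcov, hsum, hsmall⟩ := exists_cover_by_subcubes b hβ a hl hδ hδ1'
      hθ hδθ (E := E) (fun x hx => hx.1) (hc a l hl hQ)
    have hdist : ∀ j, |c (a' j) (l' j) - c a l| ≤ 2 * K := by
      intro j
      obtain ⟨hl', hs⟩ := hsub j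
      -- Otherwise two sets, each of content at most a quarter of the lower bound in
      -- `le_content_cube`, would cover the subcube.
      have hex : ∃ x ∈ cube b (a' j) (l' j), x ∉ E ∧ |u x - c (a' j) (l' j)| ≤ K := by
        by_contra! hcon
        have hle : content β (cube b (a' j) (l' j)) ≤
            content β (E ∩ cube b (a' j) (l' j)) +
              content β {x | x ∈ cube b (a' j) (l' j) ∧ K < |u x - c (a' j) (l' j)|} := by
          refine (content_mono fun x hx => ?_).trans (content_union_le hβ _ _)
          by_cases hxE : x ∈ E
          · exact Or.inl ⟨hxE, hx⟩
          · exact Or.inr ⟨hx, hcon x hx hxE⟩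
        have hP : 0 < l' j ^ β := by positivity
        have h1 := ((le_content_cube b hβ hβd (a' j) hl').trans hle).trans
          (add_le_add (hsmall j) (hc _ _ hl' (hs.trans hQ)).le)
        have hθ0 : 0 < θ := lt_trans (by positivity) hδθ
        rw [← ENNReal.ofReal_add (by positivity) (by positivity),
          ENNReal.ofReal_le_ofReal_iff (by positivity), ← add_mul] at h1
        have h2 := le_of_mul_le_mul_right h1 hP
        have h3 : ballConst β * ((d + 1) ^ β * θ) ≤ ballConst β * (1 / (4 * 2 ^ d)) := by gcongr
        have h4 : ballConst β * δ ≤ ballConst β * (1 / (4 * 2 ^ d)) := by gcongr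
        have h5 : ballConst β / 2 ^ d = 4 * (ballConst β * (1 / (4 * 2 ^ d))) := by field_simp
        have h6 : 0 < ballConst β * (1 / (4 * 2 ^ d)) := by positivity
        linarith
      obtain ⟨x, hx, hxE, hxK⟩ := hex
      have hxK' : |u x - c a l| ≤ K := by
        by_contra! h
        exact hxE ⟨hs hx, h⟩
      rw [abs_le] at hxK hxK' ⊢
      constructor <;> linarith [hxK.1, hxK.2, hxK'.1, hxK'.2]
    calc content β {x | x ∈ cube b a l ∧ ((n + 1 : ℕ) : ℝ) * (2 * K) < |u x - c a l|}
        ≤ content β (⋃ j, {x | x ∈ cube b (a' j) (l' j) ∧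
            n * (2 * K) < |u x - c (a' j) (l' j)|}) := by
          refine content_mono ?_
          rintro x ⟨hx, hlt⟩
          push_cast at hlt
          have hnK : 0 ≤ n * (2 * K) := by positivity
          obtain ⟨j, hj⟩ := Set.mem_iUnion.1 (hcov ⟨hx, show K < |u x - c a l| by linarith⟩)
          refine Set.mem_iUnion.2 ⟨j, hj, ?_⟩
          have htri := abs_sub_le (u x) (c (a' j) (l' j)) (c a l)
          linarith [hdist j]
      _ ≤ ∑' j, content β {x | x ∈ cube b (a' j) (l' j) ∧
            n * (2 * K) < |u x - c (a' j) (l' j)|} := content_iUnion_le hβ _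
      _ ≤ ∑' j, ENNReal.ofReal (ballConst β * (d + 1) ^ β * (1 / 2) ^ n) *
            ENNReal.ofReal (l' j ^ β) := by
          refine ENNReal.tsum_le_tsum fun j => ?_
          rw [← ENNReal.ofReal_mul (by positivity)]
          exact ih _ _ (hsub j).1 ((hsub j).2.trans hQ)
      _ ≤ ENNReal.ofReal (ballConst β * (d + 1) ^ β * (1 / 2) ^ n) *
            ENNReal.ofReal (1 / 2 * l ^ β) := by
          rw [ENNReal.tsum_mul_left]
          gcongr
          refine hsum.trans (ENNReal.ofReal_le_ofReal ?_)
          gcongr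
      _ = _ := by
          rw [← ENNReal.ofReal_mul (by positivity)]
          congr 1
          ring

/-! ### Exponential integrability -/

/-- Geometric decay of the superlevel sets implies exponential integrability. -/
theorem choquet_exp_le {Q : Set (EuclideanSpace ℝ (Fin d))} {f : EuclideanSpace ℝ (Fin d) → ℝ}
    {T M : ℝ} (hT : 0 < T) (hM : 0 ≤ M) (hQ : content β Q ≤ ENNReal.ofReal M)
    (h : ∀ n : ℕ, content β {x | x ∈ Q ∧ n * T < f x} ≤ ENNReal.ofReal (M * (1 / 2) ^ n)) :
    choquet β Q (fun x => Real.exp (Real.log 2 / (2 * T) * f x)) ≤ ENNReal.ofReal (3 * M) := by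
  have hlog2 : 0 < Real.log 2 := Real.log_pos one_lt_two
  have htail : ∀ t ∈ Set.Ioi (1 : ℝ),
      content β {x | x ∈ Q ∧ t < Real.exp (Real.log 2 / (2 * T) * f x)} ≤
        ENNReal.ofReal (2 * M * t ^ (-2 : ℝ)) := by
    intro t ht
    have ht1 : (1 : ℝ) < t := ht
    have ht0 : 0 < t := by linarith
    have hlogt : 0 < Real.log t := Real.log_pos ht1
    -- The condition `exp (…) > t` means `f > s * T`, and `2^(-s) = t^(-2)`. The `2` in the
    -- exponent's denominator makes this tail integrable; rounding `s` down costs another factor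
    -- `2`.
    set s := 2 * Real.log t / Real.log 2 with hs
    have hs0 : 0 ≤ s := by positivity
    refine (content_mono (T := {x | x ∈ Q ∧ (⌊s⌋₊ : ℝ) * T < f x}) ?_).trans
      ((h ⌊s⌋₊).trans (ENNReal.ofReal_le_ofReal ?_))
    · rintro x ⟨hx, hlt⟩
      refine ⟨hx, ?_⟩
      rw [← Real.log_lt_iff_lt_exp ht0] at hlt
      have h1 : s * T < f x := by
        have h2 : Real.log t = Real.log 2 / (2 * T) * (s * T) := by
          rw [hs]
          field_simp
        rw [h2] at hlt
        exact lt_of_mul_lt_mul_left hlt (by positivity)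
      exact (mul_le_mul_of_nonneg_right (Nat.floor_le hs0) hT.le).trans_lt h1
    · have h1 : ((1 : ℝ) / 2) ^ ⌊s⌋₊ ≤ 2 * t ^ (-2 : ℝ) := by
        have h2 : ((1 : ℝ) / 2) ^ (⌊s⌋₊ + 1) ≤ t ^ (-2 : ℝ) := by
          rw [← Real.rpow_natCast, one_div, Real.inv_rpow (by norm_num), ← Real.rpow_neg (by norm_num),
            Real.rpow_def_of_pos (by norm_num), Real.rpow_def_of_pos ht0, Real.exp_le_exp]
          have h3 := (Nat.lt_floor_add_one s).le
          have h4 : Real.log t * 2 = Real.log 2 * s := by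
            rw [hs]
            field_simp
          push_cast
          nlinarith
        rw [pow_succ] at h2
        linarith
      calc M * (1 / 2) ^ ⌊s⌋₊ ≤ M * (2 * t ^ (-2 : ℝ)) := by gcongr
        _ = _ := by ring
  have hint : ∫⁻ t in Set.Ioi (1 : ℝ), ENNReal.ofReal (2 * M * t ^ (-2 : ℝ)) =
      ENNReal.ofReal (2 * M) := by
    rw [← MeasureTheory.ofReal_integral_eq_lintegral_ofReal]
    · rw [MeasureTheory.integral_const_mul, integral_Ioi_rpow_of_lt (by norm_num) one_pos]
      norm_num
    · exact (integrableOn_Ioi_rpow_of_lt (by norm_num) one_pos).const_mul _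
    · filter_upwards [MeasureTheory.ae_restrict_mem measurableSet_Ioi] with t ht
      have : (0 : ℝ) < t := one_pos.trans ht
      positivity
  rw [choquet, ← Set.Ioc_union_Ioi_eq_Ioi (zero_le_one (α := ℝ))]
  calc ∫⁻ t in Set.Ioc (0 : ℝ) 1 ∪ Set.Ioi 1,
        content β {x | x ∈ Q ∧ t < Real.exp (Real.log 2 / (2 * T) * f x)}
      ≤ (∫⁻ _ in Set.Ioc (0 : ℝ) 1, ENNReal.ofReal M) +
          ∫⁻ t in Set.Ioi (1 : ℝ), ENNReal.ofReal (2 * M * t ^ (-2 : ℝ)) := by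
        refine (MeasureTheory.lintegral_union_le _ _ _).trans (add_le_add ?_ ?_)
        · exact MeasureTheory.lintegral_mono fun t => (content_mono fun x hx => hx.1).trans hQ
        · exact MeasureTheory.setLIntegral_mono' measurableSet_Ioi htail
    _ = ENNReal.ofReal (3 * M) := by
        rw [hint, MeasureTheory.setLIntegral_const, Real.volume_Ioc, sub_zero, ENNReal.ofReal_one,
          mul_one, ← ENNReal.ofReal_add hM (by positivity)]
        congr 1
        ring

end HausdorffBMO

end

/-! ### Choice of constants and conclusion -/

/-- The constants `c'`, `C'` depend only on `d` and `β`. The frame `b` is the orientation of `Q₀`, so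
that the subcubes `cube b a l` are those parallel to `Q₀`; `Q₀` is a finite cube with that
orientation or the infinite cube `ℝ^d`. -/
theorem corollary1p4 (d : ℕ) (β : ℝ) (hβ : 0 < β) (hβd : β ≤ d) :
    ∃ c' C' : ℝ, 0 < c' ∧ 0 < C' ∧
      ∀ (b : OrthonormalBasis (Fin d) ℝ (EuclideanSpace ℝ (Fin d)))
        (Q₀ : Set (EuclideanSpace ℝ (Fin d))),
        ((∃ (a₀ : Fin d → ℝ) (l₀ : ℝ), 0 < l₀ ∧ Q₀ = HausdorffBMO.cube b a₀ l₀) ∨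
          Q₀ = Set.univ) →
        ∀ u : EuclideanSpace ℝ (Fin d) → ℝ,
          HausdorffBMO.MemBMO β b Q₀ u → HausdorffBMO.bmoNorm β b Q₀ u ≤ 1 →
          ∀ (a : Fin d → ℝ) (l : ℝ), 0 < l → HausdorffBMO.cube b a l ⊆ Q₀ →
            ∃ cQ : ℝ,
              HausdorffBMO.choquet β (HausdorffBMO.cube b a l)
                  (fun x => Real.exp (c' * |u x - cQ|)) ≤
                ENNReal.ofReal (C' * l ^ β) := by
  have hω := HausdorffBMO.ballConst_pos hβ
  have hP1 : (1 : ℝ) ≤ 2 ^ d := one_le_pow₀ (by norm_num)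
  have hA1 : (1 : ℝ) ≤ (d + 1) ^ β := Real.one_le_rpow (by simp) hβ.le
  have hB1 : (1 : ℝ) ≤ 2 ^ β := Real.one_le_rpow (by norm_num) hβ.le
  have hD1 : (1 : ℝ) ≤ 3 ^ d := one_le_pow₀ (by norm_num)
  -- `θ` makes `(d+1)^β θ` equal to `1/(4·2^d)`, and `δ` below makes the total size of the subcubes
  -- exactly half.
  obtain ⟨θ, hθdef⟩ : ∃ θ : ℝ, θ = 1 / (4 * 2 ^ d) / (d + 1) ^ β := ⟨_, rfl⟩
  have hθ0 : 0 < θ := by rw [hθdef]; positivity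
  have hθP : θ ≤ 1 / (4 * 2 ^ d) := hθdef ▸ div_le_self (by positivity) hA1
  have hθ1 : θ ≤ 1 := hθP.trans <| (div_le_one (by positivity)).2 (by linarith)
  obtain ⟨δ, hδdef⟩ : ∃ δ : ℝ, δ = θ / (2 * 2 ^ β * (3 ^ d * 2 ^ β)) := ⟨_, rfl⟩
  have hδ0 : 0 < δ := by rw [hδdef]; positivity
  have hDB : (1 : ℝ) ≤ 3 ^ d * 2 ^ β := one_le_mul_of_one_le_of_one_le hD1 hB1
  have hδθ : δ ≤ θ := by
    rw [hδdef]
    exact div_le_self hθ0.le (one_le_mul_of_one_le_of_one_le (by linarith) hDB)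
  have hlt : 3 ^ d * 2 ^ β * δ < θ := by
    have : 3 ^ d * 2 ^ β * δ = θ / (2 * 2 ^ β) := by rw [hδdef]; field_simp
    rw [this]
    exact div_lt_self hθ0 (by linarith)
  have hhalf : 2 ^ β * (3 ^ d * 2 ^ β * δ / θ) ≤ 1 / 2 := by
    rw [hδdef]
    apply le_of_eq
    field_simp
  -- Chebyshev needs `K ω_β δ > 2`; the numerator `3` makes this strict.
  obtain ⟨K, hKdef⟩ : ∃ K : ℝ, K = 3 / (HausdorffBMO.ballConst β * δ) := ⟨_, rfl⟩
  have hK0 : 0 < K := by rw [hKdef]; positivity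
  refine ⟨Real.log 2 / (2 * (2 * K)), 3 * (HausdorffBMO.ballConst β * (d + 1) ^ β),
    div_pos (Real.log_pos one_lt_two) (by positivity), by positivity, ?_⟩
  intro b Q₀ _ u _ hu a l hl hQ
  -- One constant is fixed per cube, with the dummy value `0` for inadmissible `(a, l)`, so that the
  -- induction can compare constants of different cubes.
  have hex : ∀ a l, ∃ c : ℝ, 0 < l → HausdorffBMO.cube b a l ⊆ Q₀ →
      HausdorffBMO.choquet β (HausdorffBMO.cube b a l) (fun x => |u x - c|) ≤
        ENNReal.ofReal (2 * l ^ β) := by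
    intro a l
    by_cases h : 0 < l ∧ HausdorffBMO.cube b a l ⊆ Q₀
    · obtain ⟨c, hc⟩ := HausdorffBMO.exists_choquet_le_of_bmoNorm_le_one b hu h.1 h.2
      exact ⟨c, fun _ _ => hc⟩
    · exact ⟨0, fun h1 h2 => absurd ⟨h1, h2⟩ h⟩
  choose c hc using hex
  have hsmall : ∀ a l, 0 < l → HausdorffBMO.cube b a l ⊆ Q₀ →
      HausdorffBMO.content β {x | x ∈ HausdorffBMO.cube b a l ∧ K < |u x - c a l|} <
        ENNReal.ofReal (HausdorffBMO.ballConst β * δ * l ^ β) := by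
    intro a l hl hQ
    have hlβ : 0 < l ^ β := by positivity
    have hlt : ENNReal.ofReal (2 * l ^ β) <
        ENNReal.ofReal K * ENNReal.ofReal (HausdorffBMO.ballConst β * δ * l ^ β) := by
      rw [← ENNReal.ofReal_mul hK0.le, ENNReal.ofReal_lt_ofReal_iff (by positivity), hKdef]
      field_simp
      norm_num
    exact lt_of_mul_lt_mul_left' <|
      ((HausdorffBMO.mul_content_lt_le_choquet _ _ K).trans (hc a l hl hQ)).trans_lt hlt
  have hdecay := HausdorffBMO.content_superlevel_le_pow b hβ hβd hδ0 (hδθ.trans hθP)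
    (by rw [hθdef]; apply le_of_eq; field_simp) hθ1 hlt hhalf hK0.le hsmall
  refine ⟨c a l, ?_⟩
  have hfinal := HausdorffBMO.choquet_exp_le (β := β) (Q := HausdorffBMO.cube b a l)
    (f := fun x => |u x - c a l|) (T := 2 * K)
    (M := HausdorffBMO.ballConst β * (d + 1) ^ β * l ^ β) (by positivity) (by positivity)
    (HausdorffBMO.content_cube_le b hβ a hl) fun n => (hdecay n a l hl hQ).trans (le_of_eq (by
      congr 1
      ring))
  rwa [← mul_assoc 3] at hfinal
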